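/- A semigroup $S$ is \emph{completely simple} if its only two-sided ideal is $S$ itself and it has a minimal left ideal and a minimal right ideal (ideals are nonempty). Such a semigroup is a union of groups, and $x^{-1}$ denotes the inverse of $x\in S$ in the maximal subgroup containing $x$, i.e. the unique $y\in S$ with $xyx=x$, $yxy=y$ and $xy=yx$. A completely simple semigroup $S$ together with a map $\iota\colon X\to S$ is \emph{free on} $X$ (of \emph{rank} $|X|$) if for every completely simple semigroup $T$ and every map $f\colon X\to T$ there is a unique homomorphism $\varphi\colon S\to T$ with $\varphi\circ\iota=f$. Let $\mathcal L_S=\{\cdot,{}^{-1}\}\cup\{s\mid s\in S\}$ be the language of multiplication and inversion extended by a constant for each element of $S$. An \emph{equation} in variables $x_1,\dots,x_m$ is an equality $t=t'$ of two $\mathcal L_S$-terms in these variables, and a set $Y\subseteq S^m$ is \emph{algebraic} if it is the set of all solutions in $S^m$ of some (possibly infinite) system of equations in $x_1,\dots,x_m$. The semigroup $S$ is an \emph{equational domain in the language $\mathcal L_S$} if for every $m$ the union $Y_1\cup\dots\cup Y_k$ ($k\ge 1$) of any finitely many algebraic subsets of $S^m$ is algebraic. \textbf{Statement.} Let $n\ge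 2$ be an integer, let $X$ be a set with $n$ elements, and let $S=F_{css}(X)$ be a free completely simple semigroup on $X$. Then $S$ is an equational domain in the language $\mathcal L_S$. -/

import Mathlib

universe u v

/-- A nonempty left ideal `A` of a semigroup: `s * a ∈ A` for all `s ∈ S`, `a ∈ A`. -/
def IsLeftIdeal {S : Type u} [Semigroup S] (A : Set S) : Prop :=
  A.Nonempty ∧ ∀ s : S, ∀ a ∈ A, s * a ∈ A

/-- A nonempty right ideal `A` of a semigroup: `a * s ∈ A` for all `s ∈ S`, `a ∈ A`. -/
def IsRightIdeal {S : Type u} [Semigroup S] (A : Set S) : Prop :=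
  A.Nonempty ∧ ∀ s : S, ∀ a ∈ A, a * s ∈ A

/-- A semigroup is completely simple if its only two-sided ideal is the whole semigroup, and it
has a minimal left ideal and a minimal right ideal. (A minimal left ideal being nonempty, such
a semigroup is nonempty.) -/
class IsCompletelySimple (S : Type u) [Semigroup S] : Prop where
  simple : ∀ A : Set S, IsLeftIdeal A → IsRightIdeal A → A = Set.univ
  exists_minimal_left : ∃ A : Set S, Minimal IsLeftIdeal A
  exists_minimal_right : ∃ A : Set S, Minimal IsRightIdeal A

/-- `y` is the inverse of `x` in a subgroup of the semigroup `S` containing `x`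
(the identity element of the subgroup being `x * y = y * x`). -/
def IsGroupInverse {S : Type u} [Semigroup S] (x y : S) : Prop :=
  x * y * x = x ∧ y * x * y = y ∧ x * y = y * x

theorem IsGroupInverse.unique {S : Type u} [Semigroup S] {x y z : S}
    (hy : IsGroupInverse x y) (hz : IsGroupInverse x z) : y = z := by
  obtain ⟨hy1, hy2, hy3⟩ := hy
  obtain ⟨hz1, hz2, hz3⟩ := hz
  have h1 : x * y = x * z := by
    calc x * y = x * z * x * y := by rw [hz1]
      _ = z * x * (y * x) := by rw [hz3, ← hy3]; simp only [mul_assoc]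
      _ = z * (x * y * x) := by simp only [mul_assoc]
      _ = x * z := by rw [hy1, hz3]
  calc y = y * (x * y) := by rw [← mul_assoc, hy2]
    _ = y * x * z := by rw [h1, mul_assoc]
    _ = z * x * z := by rw [← hy3, h1, hz3]
    _ = z := hz2

theorem IsCompletelySimple.exists_eq_mul_mul_self {S : Type u} [Semigroup S]
    [IsCompletelySimple S] (x : S) : ∃ u : S, x = u * x * x := by
  obtain ⟨L, ⟨⟨l, hl⟩, hLmul⟩, hLmin⟩ := IsCompletelySimple.exists_minimal_left (S := S)
  have hU := IsCompletelySimple.simple {z : S | ∃ c ∈ L, ∃ a, z = c * a}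
    ⟨⟨l * l, l, hl, l, rfl⟩, by
      rintro s _ ⟨c, hc, a, rfl⟩
      exact ⟨s * c, hLmul s c hc, a, (mul_assoc _ _ _).symm⟩⟩
    ⟨⟨l * l, l, hl, l, rfl⟩, by
      rintro s _ ⟨c, hc, a, rfl⟩
      exact ⟨c, hc, a * s, mul_assoc _ _ _⟩⟩
  have hx : x ∈ {z : S | ∃ c ∈ L, ∃ a, z = c * a} := hU ▸ Set.mem_univ x
  obtain ⟨c, hc, a, hxca⟩ := hx
  have hK : IsLeftIdeal {d : S | d ∈ L ∧ ∃ u, d * a = u * x * x} := by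
    refine ⟨⟨x * x * c, hLmul _ _ hc, x, ?_⟩, ?_⟩
    · rw [mul_assoc (x * x), ← hxca]
    · rintro s d ⟨hd, u, hu⟩
      exact ⟨hLmul s d hd, s * u, by rw [mul_assoc s d, hu]; simp only [mul_assoc]⟩
  obtain ⟨-, u, hu⟩ := hLmin hK (fun d hd => hd.1) hc
  exact ⟨u, hxca.trans hu⟩

theorem IsCompletelySimple.exists_eq_self_mul_mul {S : Type u} [Semigroup S]
    [IsCompletelySimple S] (x : S) : ∃ v : S, x = x * x * v := by
  obtain ⟨R, ⟨⟨r, hr⟩, hRmul⟩, hRmin⟩ := IsCompletelySimple.exists_minimal_right (S := S)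
  have hU := IsCompletelySimple.simple {z : S | ∃ c ∈ R, ∃ a, z = a * c}
    ⟨⟨r * r, r, hr, r, rfl⟩, by
      rintro s _ ⟨c, hc, a, rfl⟩
      exact ⟨c, hc, s * a, (mul_assoc _ _ _).symm⟩⟩
    ⟨⟨r * r, r, hr, r, rfl⟩, by
      rintro s _ ⟨c, hc, a, rfl⟩
      exact ⟨c * s, hRmul s c hc, a, mul_assoc _ _ _⟩⟩
  have hx : x ∈ {z : S | ∃ c ∈ R, ∃ a, z = a * c} := hU ▸ Set.mem_univ x
  obtain ⟨c, hc, a, hxca⟩ := hx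
  have hK : IsRightIdeal {d : S | d ∈ R ∧ ∃ v, a * d = x * x * v} := by
    refine ⟨⟨c * (x * x), hRmul _ _ hc, x, ?_⟩, ?_⟩
    · rw [← mul_assoc a, ← hxca, mul_assoc]
    · rintro s d ⟨hd, v, hv⟩
      exact ⟨hRmul s d hd, v * s, by rw [← mul_assoc a d, hv]; simp only [mul_assoc]⟩
  obtain ⟨-, v, hv⟩ := hRmin hK (fun d hd => hd.1) hc
  exact ⟨v, hxca.trans hv⟩

theorem IsCompletelySimple.exists_isGroupInverse {S : Type u} [Semigroup S]
    [IsCompletelySimple S] (x : S) : ∃ y : S, IsGroupInverse x y := by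
  obtain ⟨u, hu⟩ := IsCompletelySimple.exists_eq_mul_mul_self x
  obtain ⟨v, hv⟩ := IsCompletelySimple.exists_eq_self_mul_mul x
  have h1 : u * x = x * v := by
    calc u * x = u * (x * x * v) := by rw [← hv]
      _ = u * x * x * v := by simp only [mul_assoc]
      _ = x * v := by rw [← hu]
  have h2 : x * v * x = x := by rw [← h1, ← hu]
  have hxy : x * (x * v * v) = x * v := by
    calc x * (x * v * v) = x * x * v * v := by simp only [mul_assoc]
      _ = x * v := by rw [← hv]
  have hyx : x * v * v * x = x * v := by
    calc x * v * v * x = u * x * v * x := by rw [h1]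
      _ = u * (x * v * x) := by simp only [mul_assoc]
      _ = x * v := by rw [h2, h1]
  refine ⟨x * v * v, ?_, ?_, hxy.trans hyx.symm⟩
  · rw [hxy, h2]
  · rw [hyx]
    calc x * v * (x * v * v) = x * v * x * v * v := by simp only [mul_assoc]
      _ = x * v * v := by rw [h2]

/-- The inversion of a completely simple semigroup: the inverse of `x` in the maximal subgroup
containing `x`. -/
noncomputable def groupInverse {S : Type u} [Semigroup S] [IsCompletelySimple S] (x : S) : S :=
  Classical.choose (IsCompletelySimple.exists_isGroupInverse x)

theorem groupInverse_spec {S : Type u} [Semigroup S] [IsCompletelySimple S] (x : S) :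
    IsGroupInverse x (groupInverse x) :=
  Classical.choose_spec (IsCompletelySimple.exists_isGroupInverse x)

/-- Terms in the variables `x₁, …, xₙ` of the language `{·, ⁻¹} ∪ {s | s ∈ S}`. -/
inductive CSTerm (S : Type u) (n : ℕ) : Type u
  | var (i : Fin n) : CSTerm S n
  | const (s : S) : CSTerm S n
  | mul (t₁ t₂ : CSTerm S n) : CSTerm S n
  | inv (t : CSTerm S n) : CSTerm S n

/-- The value of a term at a point of `Sⁿ`. -/
noncomputable def CSTerm.eval {S : Type u} [Semigroup S] [IsCompletelySimple S] {n : ℕ}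
    (p : Fin n → S) : CSTerm S n → S
  | .var i => p i
  | .const s => s
  | .mul t₁ t₂ => t₁.eval p * t₂.eval p
  | .inv t => groupInverse (t.eval p)

/-- The solution set of a system of equations, an equation `t = s` being the pair `(t, s)`. -/
def solutionSet {S : Type u} [Semigroup S] [IsCompletelySimple S] {n : ℕ}
    (E : Set (CSTerm S n × CSTerm S n)) : Set (Fin n → S) :=
  {p | ∀ e ∈ E, e.1.eval p = e.2.eval p}

/-- A subset of `Sⁿ` is algebraic if it is the solution set of some (possibly infinite) system
of equations with constants from `S`. -/
def IsAlgebraicSet {S : Type u} [Semigroup S] [IsCompletelySimple S] {n : ℕ}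
    (Y : Set (Fin n → S)) : Prop :=
  ∃ E : Set (CSTerm S n × CSTerm S n), solutionSet E = Y

/-- `S` is an equational domain if, for every `n`, the union of any finite (nonempty) collection
of algebraic subsets of `Sⁿ` is algebraic. -/
def IsEquationalDomain (S : Type u) [Semigroup S] [IsCompletelySimple S] : Prop :=
  ∀ (n : ℕ) (F : Set (Set (Fin n → S))), F.Finite → F.Nonempty →
    (∀ Y ∈ F, IsAlgebraicSet Y) → IsAlgebraicSet (⋃₀ F)

/-- The completely simple semigroup `S` is free on the family `ι : X → S`: every map from `X` to
a completely simple semigroup `T` extends uniquely to a homomorphism `S → T`. (Semigroup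
homomorphisms between completely simple semigroups automatically preserve the inversion.) -/
def IsFreeCompletelySimple {S : Type u} [Semigroup S] [IsCompletelySimple S] {X : Type v}
    (ι : X → S) : Prop :=
  ∀ (T : Type u) [Semigroup T] [IsCompletelySimple T] (f : X → T),
    ∃! φ : S →ₙ* T, ∀ x : X, φ (ι x) = f x

/-! For an idempotent `e`, the set `eSe` is a group `G`. Two properties suffice. Separation: if `s ≠
t`, then `ecsde ≠ ectde` for some `c, d`. Domain property: if `x, y ≠ 1` in `G`, then `x` fails to
commute with some conjugate of `y`. By separation an equation amounts to a system `x = 1` with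
values in `G`; by the domain property, "`x = 1` or `y = 1`" amounts to `x` commuting with `gyg⁻¹`
for all `g ∈ G`. So unions of algebraic sets are algebraic (`isAlgebraicSet_union`).

A free `S` embeds in a Rees matrix semigroup whose sandwich entries are free generators of a group
(`exists_injective`). Independence of the entries gives separation. It also makes `G` a
noncommutative subgroup of a free group, where the domain property follows from cyclicity of
centralizers (`exists_not_commute_conj`). -/

/-! ### Centralizers and conjugates in free groups -/

section FreeGroups

theorem FreeGroup.subsingleton_of_mem_center {α : Type*} {z : FreeGroup α} (hz : z ≠ 1)
    (hc : ∀ g, Commute z g) : Subsingleton α := by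
  classical
  by_contra hα
  rw [not_subsingleton_iff_nontrivial] at hα
  have hw : z.toWord ≠ [] := by simpa using hz
  obtain ⟨⟨x, ε⟩, w, hxw⟩ := List.exists_cons_of_ne_nil hw
  obtain ⟨w', ⟨y, δ⟩, hyw⟩ := List.eq_nil_or_concat z.toWord |>.resolve_left hw
  obtain ⟨c, hcx⟩ := exists_ne x
  have hred : FreeGroup.IsReduced z.toWord := FreeGroup.isReduced_toWord
  have h1 : FreeGroup.IsReduced ((c, δ) :: z.toWord) := by
    rw [hxw] at hred ⊢
    exact List.isChain_cons_cons.2 ⟨fun h => absurd h hcx, hred⟩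
  have h2 : FreeGroup.IsReduced (z.toWord ++ [(c, δ)]) := by
    rw [hyw] at hred ⊢
    -- The new letter has the exponent `δ` of the last letter of `z`, so nothing cancels even if `y
    -- = c`.
    refine List.IsChain.append hred (List.isChain_singleton _) ?_
    intro a ha b hb
    simp at ha hb
    subst ha hb
    simp
  have h3 := hc (FreeGroup.mk [(c, δ)])
  have h4 : FreeGroup.mk (z.toWord ++ [(c, δ)]) = FreeGroup.mk ((c, δ) :: z.toWord) := by
    rw [← FreeGroup.mul_mk, FreeGroup.mk_toWord, h3.eq]
    nth_rw 1 [← FreeGroup.mk_toWord (x := z)]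
    rw [FreeGroup.mul_mk, List.singleton_append]
  have h5 := congrArg FreeGroup.toWord h4
  rw [FreeGroup.toWord_mk, FreeGroup.toWord_mk, h1.reduce_eq, h2.reduce_eq, hxw] at h5
  simp only [List.cons_append, List.cons.injEq, Prod.mk.injEq] at h5
  exact hcx h5.1.1.symm

namespace IsFreeGroup

variable {G : Type u} [Group G] [IsFreeGroup G]

theorem isCyclic_of_mem_center {z : G} (hz : z ≠ 1) (hc : ∀ g, Commute z g) : IsCyclic G := by
  have hs : Subsingleton (Generators G) := by
    refine FreeGroup.subsingleton_of_mem_center (z := toFreeGroup G z) (by simpa using hz) ?_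
    intro g
    simpa using (hc ((toFreeGroup G).symm g)).map (toFreeGroup G)
  rcases isEmpty_or_nonempty (Generators G) with h | h
  · have : Subsingleton G := (toFreeGroup G).injective.subsingleton
    infer_instance
  · obtain ⟨a⟩ := h
    let : Unique (Generators G) := uniqueOfSubsingleton a
    exact (toFreeGroup G).isCyclic.2 inferInstance

/-- The centralizer is free by Nielsen–Schreier, and `z` is a nontrivial central element of it. -/
theorem isCyclic_centralizer {z : G} (hz : z ≠ 1) : IsCyclic (Subgroup.centralizer {z}) := by
  refine isCyclic_of_mem_center
    (z := (⟨z, Subgroup.mem_centralizer_singleton_iff.2 rfl⟩ : Subgroup.centralizer {z})) ?_ ?_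
  · simpa [Subtype.ext_iff] using hz
  · rintro ⟨g, hg⟩
    exact Subtype.ext (Subgroup.mem_centralizer_singleton_iff.1 hg).symm

theorem commute_trans {x y z : G} (hz : z ≠ 1) (hx : Commute x z) (hy : Commute y z) :
    Commute x y := by
  have := isCyclic_centralizer hz
  have h := IsCyclic.isMulCommutative (α := Subgroup.centralizer {z})
  exact congrArg Subtype.val (h.is_comm.comm
    (⟨x, Subgroup.mem_centralizer_singleton_iff.2 hx⟩ : Subgroup.centralizer {z})
    ⟨y, Subgroup.mem_centralizer_singleton_iff.2 hy⟩)

theorem isMulTorsionFree : IsMulTorsionFree G :=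
  Function.Injective.isMulTorsionFree (toFreeGroup G).toMonoidHom (toFreeGroup G).injective

/-- Otherwise, by transitivity of commutation, all conjugates of `y` commute with `y`, so the
centralizer `⟨c⟩` of `y` is normal. Each `g` then sends `c` to `c ^ (±1)`, hence `g ^ 2` centralizes
`c`, hence so does `g`, and the group is commutative. -/
theorem exists_not_commute_conj {a b : G} (hab : ¬ Commute a b) {x y : G} (hx : x ≠ 1)
    (hy : y ≠ 1) : ∃ g, ¬ Commute x (g * y * g⁻¹) := by
  have := isMulTorsionFree (G := G)
  by_contra! h
  have h1 : ∀ g, Commute y (g * y * g⁻¹) := fun g =>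
    commute_trans hx (by simpa using (h 1).symm) (h g).symm
  obtain ⟨⟨c, hcy⟩, hc⟩ := isCyclic_centralizer hy
  rw [Subgroup.mem_centralizer_singleton_iff] at hcy
  have hc' : ∀ z, Commute z y → ∃ k : ℤ, c ^ k = z := fun z hz => by
    obtain ⟨k, hk⟩ := hc ⟨z, Subgroup.mem_centralizer_singleton_iff.2 hz⟩
    exact ⟨k, by simpa using congrArg Subtype.val hk⟩
  have hc1 : c ≠ 1 := by
    rintro rfl
    obtain ⟨k, hk⟩ := hc' y (Commute.refl y)
    exact hy (by simpa using hk.symm)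
  have hconj : ∀ g, ∃ k : ℤ, c ^ k = g * c * g⁻¹ := fun g => by
    apply hc'
    have h2 : Commute c (g⁻¹ * y * g) := commute_trans hy hcy (by simpa using (h1 g⁻¹).symm)
    have h3 := h2.map (MulAut.conj g)
    simpa [mul_assoc] using h3
  have hsq : ∀ g, Commute (g ^ 2) c := fun g => by
    obtain ⟨k, hk⟩ := hconj g
    obtain ⟨l, hl⟩ := hconj g⁻¹
    have hkl : c ^ (l * k) = c ^ (1 : ℤ) := by
      rw [zpow_mul, hl, conj_zpow, hk]; group
    have hlk := injective_zpow_iff_not_isOfFinOrder.2 (not_isOfFinOrder_of_isMulTorsionFree hc1) hkl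
    have hkk : k * k = 1 := by
      rcases Int.eq_one_or_neg_one_of_mul_eq_one' hlk with h | h <;> simp [h.2]
    have : c ^ (k * k) = g * (g * c * g⁻¹) * g⁻¹ := by
      rw [zpow_mul, hk, conj_zpow, hk]
    rw [hkk, zpow_one] at this
    rw [Commute, SemiconjBy]
    nth_rw 2 [this]
    simp [pow_two, mul_assoc]
  have hall : ∀ g, Commute g c := fun g => by
    by_cases hg : g ^ 2 = 1
    · rw [pow_eq_one_iff_left (by norm_num)] at hg
      simp [hg]
    · exact commute_trans hg (Commute.self_pow g 2) (hsq g).symm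
  exact hab (commute_trans hc1 (hall a) (hall b))

end IsFreeGroup

theorem exists_not_commute_conj_of_injective {G : Type*} {F : Type u} [Group G] [Group F]
    [IsFreeGroup F] (φ : G →* F) (hφ : Function.Injective φ) {a b : G} (hab : ¬ Commute a b)
    {x y : G} (hx : x ≠ 1) (hy : y ≠ 1) : ∃ g, ¬ Commute x (g * y * g⁻¹) := by
  let e := MonoidHom.ofInjective hφ
  obtain ⟨g, hg⟩ := IsFreeGroup.exists_not_commute_conj (a := e a) (b := e b)
    (fun h => hab (by simpa using h.map e.symm)) (x := e x) (y := e y)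
    (by simpa using hx) (by simpa using hy)
  exact ⟨e.symm g, fun h => hg (by simpa using h.map e)⟩

end FreeGroups

/-! ### Maximal subgroups of completely simple semigroups -/

section CompletelySimple

variable {S : Type u} [Semigroup S] [IsCompletelySimple S]

namespace IsCompletelySimple

theorem exists_eq_mul_mul (x y : S) : ∃ u : S, u * y * x = x := by
  obtain ⟨L, ⟨⟨l, hl⟩, hLmul⟩, hLmin⟩ := IsCompletelySimple.exists_minimal_left (S := S)
  have hU := IsCompletelySimple.simple {z : S | ∃ c ∈ L, ∃ a, z = c * a}
    ⟨⟨l * l, l, hl, l, rfl⟩, by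
      rintro s _ ⟨c, hc, a, rfl⟩
      exact ⟨s * c, hLmul s c hc, a, (mul_assoc _ _ _).symm⟩⟩
    ⟨⟨l * l, l, hl, l, rfl⟩, by
      rintro s _ ⟨c, hc, a, rfl⟩
      exact ⟨c, hc, a * s, mul_assoc _ _ _⟩⟩
  obtain ⟨c, hc, a, rfl⟩ : x ∈ {z : S | ∃ c ∈ L, ∃ a, z = c * a} := hU ▸ Set.mem_univ x
  have hK : IsLeftIdeal {d : S | d ∈ L ∧ ∃ u, u * y * (c * a) = d * a} := by
    refine ⟨⟨y * y * c, hLmul _ _ hc, y, by simp only [mul_assoc]⟩, ?_⟩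
    rintro s d ⟨hd, u, hu⟩
    exact ⟨hLmul s d hd, s * u, by rw [mul_assoc s d, ← hu]; simp only [mul_assoc]⟩
  exact (hLmin hK (fun d hd => hd.1) hc).2

theorem exists_mul_mul_eq (x y : S) : ∃ v : S, x * (y * v) = x := by
  obtain ⟨R, ⟨⟨r, hr⟩, hRmul⟩, hRmin⟩ := IsCompletelySimple.exists_minimal_right (S := S)
  have hU := IsCompletelySimple.simple {z : S | ∃ c ∈ R, ∃ a, z = a * c}
    ⟨⟨r * r, r, hr, r, rfl⟩, by
      rintro s _ ⟨c, hc, a, rfl⟩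
      exact ⟨c, hc, s * a, (mul_assoc _ _ _).symm⟩⟩
    ⟨⟨r * r, r, hr, r, rfl⟩, by
      rintro s _ ⟨c, hc, a, rfl⟩
      exact ⟨c * s, hRmul s c hc, a, mul_assoc _ _ _⟩⟩
  obtain ⟨c, hc, a, rfl⟩ : x ∈ {z : S | ∃ c ∈ R, ∃ a, z = a * c} := hU ▸ Set.mem_univ x
  have hK : IsRightIdeal {d : S | d ∈ R ∧ ∃ v, a * c * (y * v) = a * d} := by
    refine ⟨⟨c * (y * y), hRmul _ _ hc, y, by simp only [mul_assoc]⟩, ?_⟩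
    rintro s d ⟨hd, v, hv⟩
    exact ⟨hRmul s d hd, v * s, by rw [← mul_assoc a d, ← hv]; simp only [mul_assoc]⟩
  exact (hRmin hK (fun d hd => hd.1) hc).2

/-- Idempotents are primitive: `e = ufe = uf` for some `u`, whence `f = ef = uff = uf = e`. -/
theorem eq_of_isIdempotentElem {e f : S} (hf : IsIdempotentElem f) (hef : e * f = f)
    (hfe : f * e = f) : f = e := by
  obtain ⟨u, hu⟩ := exists_eq_mul_mul e f
  rw [mul_assoc, hfe] at hu
  rw [← hef, ← hu, mul_assoc, hf.eq]

theorem isIdempotentElem_mul_groupInverse (x : S) : IsIdempotentElem (x * groupInverse x) := by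
  rw [IsIdempotentElem, ← mul_assoc, (groupInverse_spec x).1]

end IsCompletelySimple

open IsCompletelySimple

/-- The maximal subgroup `eSe` of a completely simple semigroup at an idempotent `e`. -/
@[ext]
structure MaximalSubgroup {S : Type u} [Semigroup S] {e : S} (he : IsIdempotentElem e) where
  val : S
  left : e * val = val
  right : val * e = val

namespace MaximalSubgroup

theorem mul_groupInverse {e s : S} (h₁ : e * s = s) (h₂ : s * e = s) : s * groupInverse s = e := by
  refine eq_of_isIdempotentElem (isIdempotentElem_mul_groupInverse s) ?_ ?_
  · rw [← mul_assoc, h₁]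
  · rw [(groupInverse_spec s).2.2, mul_assoc, h₂]

theorem groupInverse_mul {e s : S} (h₁ : e * s = s) (h₂ : s * e = s) : groupInverse s * s = e := by
  rw [← (groupInverse_spec s).2.2, mul_groupInverse h₁ h₂]

theorem mul_groupInverse_self {e s : S} (h₁ : e * s = s) (h₂ : s * e = s) :
    e * groupInverse s = groupInverse s := by
  rw [← groupInverse_mul h₁ h₂, (groupInverse_spec s).2.1]

theorem groupInverse_mul_self {e s : S} (h₁ : e * s = s) (h₂ : s * e = s) :
    groupInverse s * e = groupInverse s := by
  rw [← mul_groupInverse h₁ h₂, ← mul_assoc, (groupInverse_spec s).2.1]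

variable {e : S} {he : IsIdempotentElem e}

noncomputable instance : Group (MaximalSubgroup he) where
  mul s t := ⟨s.1 * t.1, by rw [← mul_assoc, s.left], by rw [mul_assoc, t.right]⟩
  one := ⟨e, he, he⟩
  inv s := ⟨groupInverse s.1, mul_groupInverse_self s.left s.right,
    groupInverse_mul_self s.left s.right⟩
  mul_assoc _ _ _ := MaximalSubgroup.ext (mul_assoc _ _ _)
  one_mul s := MaximalSubgroup.ext s.left
  mul_one s := MaximalSubgroup.ext s.right
  inv_mul_cancel s := MaximalSubgroup.ext (groupInverse_mul s.left s.right)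

theorem val_mul (s t : MaximalSubgroup he) : (s * t).1 = s.1 * t.1 := rfl

theorem val_inv (s : MaximalSubgroup he) : (s⁻¹).1 = groupInverse s.1 := rfl

/-- The sandwich map `s ↦ ese` onto the maximal subgroup at `e`. -/
def corner {S : Type u} [Semigroup S] {e : S} (he : IsIdempotentElem e) (s : S) :
    MaximalSubgroup he :=
  ⟨e * s * e, by rw [← mul_assoc, ← mul_assoc, he.eq], by rw [mul_assoc, he.eq]⟩

/-- With `x = (ese)⁻¹` one has `xsx = x`; since `s = sxv` for some `v`, also `sxs = sxsxv = sxv =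
s`. -/
theorem mul_inv_corner_mul (s : S) : s * (corner he s)⁻¹.1 * s = s := by
  obtain ⟨v, hv⟩ := exists_mul_mul_eq s (corner he s)⁻¹.1
  have h : (corner he s)⁻¹.1 * s * (corner he s)⁻¹.1 = (corner he s)⁻¹.1 := by
    calc (corner he s)⁻¹.1 * s * (corner he s)⁻¹.1
        = ((corner he s)⁻¹.1 * e) * s * (e * (corner he s)⁻¹.1) := by
          rw [(corner he s)⁻¹.left, (corner he s)⁻¹.right]
      _ = ((corner he s)⁻¹ * corner he s * (corner he s)⁻¹).1 := by
          simp only [val_mul, corner, mul_assoc]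
      _ = (corner he s)⁻¹.1 := by rw [inv_mul_cancel, one_mul]
  calc s * (corner he s)⁻¹.1 * s = s * (corner he s)⁻¹.1 * (s * ((corner he s)⁻¹.1 * v)) := by
        rw [hv]
    _ = s * ((corner he s)⁻¹.1 * s * (corner he s)⁻¹.1) * v := by simp only [mul_assoc]
    _ = s := by rw [h, mul_assoc, hv]

/-- Multiplication by `e` on the outside can be undone: `uec = c` and `dev = d` for some `u, v`. -/
theorem corner_mul_mul_ne {s t : S} {c d : S} (h : c * s * d ≠ c * t * d) :
    corner he (c * s * d) ≠ corner he (c * t * d) := by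
  intro hst
  obtain ⟨u, hu⟩ := exists_eq_mul_mul c e
  obtain ⟨v, hv⟩ := exists_mul_mul_eq d e
  have key : ∀ x, c * x * d = u * (e * (c * x * d) * e) * v := fun x => by
    nth_rw 1 [← hu, ← hv]; simp only [mul_assoc]
  exact h (by rw [key s, key t]; exact congrArg (fun x => u * x.1 * v) hst)

end MaximalSubgroup

end CompletelySimple

/-! ### Rees matrix semigroups with independent sandwich entries -/

section ReesMatrix

/-- The Rees matrix semigroup over a group with sandwich matrix `p`. -/
@[ext]
structure ReesMatrix {G I L : Type*} (p : L → I → G) where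
  row : I
  mid : G
  col : L

namespace ReesMatrix

variable {G I L : Type u} [Group G] {p : L → I → G}

instance : Mul (ReesMatrix p) :=
  ⟨fun s t => ⟨s.row, s.mid * p s.col t.row * t.mid, t.col⟩⟩

theorem mul_def (s t : ReesMatrix p) :
    s * t = ⟨s.row, s.mid * p s.col t.row * t.mid, t.col⟩ := rfl

instance : Semigroup (ReesMatrix p) where
  mul_assoc _ _ _ := by simp only [mul_def, mul_assoc]

instance [Nonempty I] [Nonempty L] : IsCompletelySimple (ReesMatrix p) where
  simple A hl hr := by
    obtain ⟨a, ha⟩ := hl.1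
    refine Set.eq_univ_of_forall fun s => ?_
    have := hr.2 ⟨a.row, (p a.col a.row)⁻¹, s.col⟩ _ (hl.2 ⟨s.row, s.mid * a.mid⁻¹ *
      (p a.col a.row)⁻¹, a.col⟩ a ha)
    simpa [mul_def] using this
  exists_minimal_left := by
    obtain ⟨l⟩ := ‹Nonempty L›
    obtain ⟨i⟩ := ‹Nonempty I›
    refine ⟨{s | s.col = l}, ⟨⟨⟨i, 1, l⟩, rfl⟩, fun s a ha => ha⟩, ?_⟩
    rintro B ⟨⟨b, hb⟩, hB⟩ hBA s hs
    have h := hB ⟨s.row, s.mid * b.mid⁻¹ * (p l b.row)⁻¹, l⟩ b hb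
    have hbl : b.col = s.col := (hBA hb).trans hs.symm
    simpa [mul_def, hbl] using h
  exists_minimal_right := by
    obtain ⟨l⟩ := ‹Nonempty L›
    obtain ⟨i⟩ := ‹Nonempty I›
    refine ⟨{s | s.row = i}, ⟨⟨⟨i, 1, l⟩, rfl⟩, fun s a ha => ha⟩, ?_⟩
    rintro B ⟨⟨b, hb⟩, hB⟩ hBA s hs
    have h := hB ⟨i, (p b.col i)⁻¹ * b.mid⁻¹ * s.mid, s.col⟩ b hb
    have hbl : b.row = s.row := (hBA hb).trans hs.symm
    simpa [mul_def, hbl, mul_assoc] using h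

end ReesMatrix

/-- The Rees matrix semigroup over a free group whose basis is the set of entries of the sandwich
matrix. -/
abbrev GenericRees (I : Type u) : Type u := ReesMatrix fun l i : I => FreeGroup.of (l, i)

namespace GenericRees

open ReesMatrix

variable {I : Type u}

/-- The elements of `GenericRees I` that play the role of free generators. -/
def gen (i : I) : GenericRees I := ⟨i, 1, i⟩

theorem gen_mul_mul_gen (k l : I) (s : GenericRees I) :
    gen k * s * gen l = ⟨k, FreeGroup.of (k, s.row) * s.mid * FreeGroup.of (s.col, l), l⟩ := by
  simp [gen, mul_def]

theorem eq_of_forall_gen_mul_mul_gen [Nontrivial I] {s t : GenericRees I}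
    (h : ∀ k l, gen k * s * gen l = gen k * t * gen l) : s = t := by
  classical
  obtain ⟨a, b, hab⟩ := exists_pair_ne I
  have hmid : ∀ k l, FreeGroup.of (k, s.row) * s.mid * FreeGroup.of (s.col, l) =
      FreeGroup.of (k, t.row) * t.mid * FreeGroup.of (t.col, l) := fun k l => by
    have := congrArg mid (h k l)
    rwa [gen_mul_mul_gen, gen_mul_mul_gen] at this
  have hχ : ∀ (f : I × I → Multiplicative ℤ) (k l : I), f (k, s.row) * FreeGroup.lift f s.mid *
      f (s.col, l) = f (k, t.row) * FreeGroup.lift f t.mid * f (t.col, l) := fun f k l => by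
    simpa using congrArg (FreeGroup.lift f) (hmid k l)
  have hrow : s.row = t.row := by
    by_contra hne
    -- `f` counts the exponent of the single letter `(a, s.row)`. Passing from `k = b` to `k = a`
    -- raises the count by one on the side of `s` only.
    let f : I × I → Multiplicative ℤ := fun x => if x = (a, s.row) then .ofAdd 1 else 1
    have h1 := hχ f a a
    have h2 := hχ f b a
    have e1 : f (a, s.row) = .ofAdd 1 := by simp [f]
    have e2 : f (a, t.row) = 1 := by simp [f, Ne.symm hne]
    have e3 : ∀ i, f (b, i) = 1 := by simp [f, hab.symm]
    rw [e1, e2] at h1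
    rw [e3, e3] at h2
    rw [mul_assoc, mul_assoc] at h1 h2
    rw [one_mul, one_mul] at h2
    rw [h2] at h1
    simp at h1
  have hcol : s.col = t.col := by
    by_contra hne
    let f : I × I → Multiplicative ℤ := fun x => if x = (s.col, a) then .ofAdd 1 else 1
    have h1 := hχ f a a
    have h2 := hχ f a b
    have e1 : f (s.col, a) = .ofAdd 1 := by simp [f]
    have e2 : f (t.col, a) = 1 := by simp [f, Ne.symm hne]
    have e3 : ∀ i, f (i, b) = 1 := by simp [f, hab.symm]
    rw [e1, e2] at h1
    rw [e3, e3, mul_one, mul_one] at h2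
    rw [h2] at h1
    simp at h1
  refine ReesMatrix.ext hrow ?_ hcol
  simpa [hrow, hcol] using hmid a a

end GenericRees

end ReesMatrix

/-! ### Embedding of the free completely simple semigroup -/

section Free

open MaximalSubgroup GenericRees

variable {I S : Type u} [Semigroup S] [IsCompletelySimple S]

/-- The homomorphism from the free group on the entries of the sandwich matrix to a maximal
subgroup of `S` that is determined by a family `ι` of elements of `S`. -/
noncomputable def entryHom {e : S} (he : IsIdempotentElem e) (ι : I → S) :
    FreeGroup (I × I) →* MaximalSubgroup he :=
  FreeGroup.lift fun x => (corner he (ι x.1))⁻¹ * corner he (ι x.1 * ι x.2)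

/-- The homomorphism `GenericRees I → S` extending a family of elements of `S`. -/
noncomputable def GenericRees.liftHom {e : S} (he : IsIdempotentElem e) (ι : I → S) :
    GenericRees I →ₙ* S where
  toFun s := ι s.row * (entryHom he ι s.mid * (corner he (ι s.col))⁻¹).1 * ι s.col
  map_mul' s t := by
    set x := (corner he (ι s.col))⁻¹ with hx
    set y := entryHom he ι t.mid with hy
    -- As `x = xe` and `y = ey`, the product between them may be replaced by its corner.
    have hxy : x.1 * (ι s.col * ι t.row) * y.1 = (x * corner he (ι s.col * ι t.row) * y).1 := by
      simp only [val_mul, corner]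
      rw [← mul_assoc x.1 (e * _), ← mul_assoc x.1 e, x.right, mul_assoc _ e, y.left]
    have hp : entryHom he ι (FreeGroup.of (s.col, t.row)) = x * corner he (ι s.col * ι t.row) := by
      simp [entryHom, hx]
    simp only [ReesMatrix.mul_def, map_mul, hp, ← hy]
    rw [mul_assoc (entryHom he ι s.mid), mul_assoc (entryHom he ι s.mid)]
    rw [val_mul, val_mul, ← hxy, val_mul, val_mul]
    simp only [mul_assoc]

theorem GenericRees.liftHom_gen {e : S} (he : IsIdempotentElem e) (ι : I → S) (i : I) :
    liftHom he ι (gen i) = ι i := by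
  change ι i * (entryHom he ι 1 * (corner he (ι i))⁻¹).1 * ι i = ι i
  rw [map_one, one_mul, mul_inv_corner_mul]

namespace IsFreeCompletelySimple

theorem comp_equiv {J : Type*} {X : Type*} {ι : X → S} (h : IsFreeCompletelySimple ι)
    (σ : J ≃ X) : IsFreeCompletelySimple (ι ∘ σ) := by
  intro T _ _ f
  obtain ⟨φ, hφ, huniq⟩ := h T (f ∘ σ.symm)
  refine ⟨φ, fun j => by simpa using hφ (σ j), fun ψ hψ => huniq ψ fun x => ?_⟩
  simpa using hψ (σ.symm x)

/-- Uniqueness in the universal property forces `liftHom` to be a left inverse of the map sending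
generators to `gen`. -/
theorem exists_injective [Nonempty I] {ι : I → S} (h : IsFreeCompletelySimple ι) :
    ∃ φ : S →ₙ* GenericRees I, Function.Injective φ ∧ ∀ i, φ (ι i) = gen i := by
  obtain ⟨φ, hφ, -⟩ := h (GenericRees I) gen
  obtain ⟨i⟩ := ‹Nonempty I›
  let ψ := liftHom (IsCompletelySimple.isIdempotentElem_mul_groupInverse (ι i)) ι
  have hψφ : ψ.comp φ = MulHom.id S :=
    (h S ι).unique (fun j => by simp [hφ, ψ, liftHom_gen]) (fun j => rfl)
  exact ⟨φ, Function.LeftInverse.injective (g := ψ) fun s => DFunLike.congr_fun hψφ s, hφ⟩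

theorem exists_corner_ne [Nontrivial I] {ι : I → S} (h : IsFreeCompletelySimple ι) {e : S}
    (he : IsIdempotentElem e) {s t : S} (hst : s ≠ t) :
    ∃ c d, corner he (c * s * d) ≠ corner he (c * t * d) := by
  obtain ⟨φ, hφ, hgen⟩ := h.exists_injective
  by_contra! hcd
  refine hst (hφ (eq_of_forall_gen_mul_mul_gen fun k l => ?_))
  have hkl : ι k * s * ι l = ι k * t * ι l := by
    by_contra hne
    exact corner_mul_mul_ne (he := he) hne (hcd _ _)
  simpa [hgen] using congrArg φ hkl

/-- The homomorphism from the maximal subgroup `eSe` to a free group induced by a homomorphism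
from `S` to a generic Rees matrix semigroup. -/
noncomputable def midHom (φ : S →ₙ* GenericRees I) {e : S} (he : IsIdempotentElem e) :
    MaximalSubgroup he →* FreeGroup (I × I) :=
  MonoidHom.mk' (fun s => (φ s.1).mid * FreeGroup.of ((φ e).col, (φ e).row)) fun s t => by
    have hs : (φ s.1).col = (φ e).col := by rw [← s.right, map_mul]; rfl
    have ht : (φ t.1).row = (φ e).row := by rw [← t.left, map_mul]; rfl
    rw [val_mul, map_mul, ReesMatrix.mul_def, hs, ht]
    simp only [mul_assoc]

theorem midHom_injective {φ : S →ₙ* GenericRees I} (hφ : Function.Injective φ) {e : S}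
    (he : IsIdempotentElem e) : Function.Injective (midHom φ he) := by
  have hrow : ∀ s : MaximalSubgroup he, (φ s.1).row = (φ e).row := fun s => by
    rw [← s.left, map_mul]; rfl
  have hcol : ∀ s : MaximalSubgroup he, (φ s.1).col = (φ e).col := fun s => by
    rw [← s.right, map_mul]; rfl
  intro s t hst
  refine MaximalSubgroup.ext (hφ (ReesMatrix.ext ?_ (mul_right_cancel hst) ?_))
  · rw [hrow, hrow]
  · rw [hcol, hcol]

theorem exists_not_commute_corner [Nontrivial I] {φ : S →ₙ* GenericRees I} {ι : I → S}
    (hgen : ∀ i, φ (ι i) = gen i) (a : I)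
    (he : IsIdempotentElem (ι a * groupInverse (ι a))) :
    ∃ x y : MaximalSubgroup he, ¬ Commute x y := by
  classical
  obtain ⟨b, hba⟩ := exists_ne a
  refine ⟨corner he (ι a), corner he (ι b), fun hc => ?_⟩
  have h := hc.map (midHom φ he)
  set e := ι a * groupInverse (ι a) with hedef
  have h1 : φ e * gen a = gen a := by
    rw [← hgen, ← map_mul, hedef, (groupInverse_spec (ι a)).1]
  have h2 : gen a * φ e = gen a := by
    rw [← hgen, ← map_mul, hedef, (groupInverse_spec (ι a)).2.2, ← mul_assoc,
      (groupInverse_spec (ι a)).1]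
  have hrow : (φ e).row = a := congrArg ReesMatrix.row h1
  have hcol : (φ e).col = a := congrArg ReesMatrix.col h2
  have hmid : (φ e).mid = (FreeGroup.of (a, a))⁻¹ := by
    have := congrArg ReesMatrix.mid h1
    simp only [ReesMatrix.mul_def, gen, hcol, mul_one] at this
    exact eq_inv_of_mul_eq_one_left this
  have hval : ∀ i, midHom φ he (corner he (ι i)) =
      (FreeGroup.of (a, a))⁻¹ * (FreeGroup.of (a, i) * FreeGroup.of (i, a)) := fun i => by
    change (φ (e * ι i * e)).mid * FreeGroup.of ((φ e).col, (φ e).row) = _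
    rw [map_mul, map_mul, hgen]
    simp [ReesMatrix.mul_def, gen, hrow, hcol, hmid, mul_assoc]
  rw [hval, hval, inv_mul_cancel_left] at h
  -- It remains to see that `p` and `p⁻¹qr` do not commute, for the distinct letters `p = (a, a)`,
  -- `q = (a, b)`, `r = (b, a)`. Noncommuting transpositions for `p`, `q` and `1` for `r` show this.
  let f : I × I → Equiv.Perm (Fin 3) := fun x =>
    if x = (a, a) then Equiv.swap 0 1 else if x = (a, b) then Equiv.swap 1 2 else 1
  have hf := h.map (FreeGroup.lift f)
  have e1 : f (a, a) = Equiv.swap 0 1 := by simp [f]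
  have e2 : f (a, b) = Equiv.swap 1 2 := by simp [f, hba]
  have e3 : f (b, a) = 1 := by simp [f, hba]
  simp only [map_mul, map_inv, FreeGroup.lift_apply_of, e1, e2, e3] at hf
  revert hf
  unfold Commute SemiconjBy
  decide

theorem exists_idempotent [Nontrivial I] {ι : I → S} (h : IsFreeCompletelySimple ι) :
    ∃ (e : S) (he : IsIdempotentElem e),
      (∀ s t, s ≠ t → ∃ c d, corner he (c * s * d) ≠ corner he (c * t * d)) ∧
      ∀ x y : MaximalSubgroup he, x ≠ 1 → y ≠ 1 → ∃ g, ¬ Commute x (g * y * g⁻¹) := by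
  obtain ⟨φ, hφ, hgen⟩ := h.exists_injective
  obtain ⟨a⟩ : Nonempty I := inferInstance
  have he := IsCompletelySimple.isIdempotentElem_mul_groupInverse (ι a)
  obtain ⟨x, y, hxy⟩ := exists_not_commute_corner hgen a he
  exact ⟨_, he, fun s t => h.exists_corner_ne he, fun _ _ =>
    exists_not_commute_conj_of_injective (midHom φ he) (midHom_injective hφ he) hxy⟩

end IsFreeCompletelySimple

end Free

/-! ### Unions of algebraic sets -/

section EquationalDomain

open MaximalSubgroup

variable {S : Type u} [Semigroup S] [IsCompletelySimple S]

namespace CSTerm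

variable {n : ℕ}

/-- The term `ete`. -/
def corner (e : S) (t : CSTerm S n) : CSTerm S n := .mul (.mul (.const e) t) (.const e)

/-- The term `(ectde)(ect'de)⁻¹`. -/
def quotient (e c d : S) (t : CSTerm S n × CSTerm S n) : CSTerm S n :=
  .mul (corner e (.mul (.mul (.const c) t.1) (.const d)))
    (.inv (corner e (.mul (.mul (.const c) t.2) (.const d))))

theorem eval_quotient {e : S} (he : IsIdempotentElem e) (c d : S) (t : CSTerm S n × CSTerm S n)
    (p : Fin n → S) :
    (quotient e c d t).eval p = (MaximalSubgroup.corner he (c * t.1.eval p * d) *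
      (MaximalSubgroup.corner he (c * t.2.eval p * d))⁻¹).1 := rfl

/-- The equation stating that `t` commutes with `gt'g⁻¹`. -/
def commuteEquation (g : S) (t t' : CSTerm S n) : CSTerm S n × CSTerm S n :=
  (.mul t (.mul (.mul (.const g) t') (.inv (.const g))),
    .mul (.mul (.mul (.const g) t') (.inv (.const g))) t)

theorem eval_commuteEquation {e : S} {he : IsIdempotentElem e} {t t' : CSTerm S n}
    {p : Fin n → S} {x y : MaximalSubgroup he} (hx : t.eval p = x.1) (hy : t'.eval p = y.1)
    (g : MaximalSubgroup he) :
    (commuteEquation g.1 t t').1.eval p = (commuteEquation g.1 t t').2.eval p ↔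
      Commute x (g * y * g⁻¹) := by
  simp only [commuteEquation, eval, hx, hy, Commute, SemiconjBy, MaximalSubgroup.ext_iff, val_mul,
    val_inv]

end CSTerm

theorem isAlgebraicSet_union {e : S} (he : IsIdempotentElem e)
    (hsep : ∀ s t, s ≠ t → ∃ c d, corner he (c * s * d) ≠ corner he (c * t * d))
    (hdom : ∀ x y : MaximalSubgroup he, x ≠ 1 → y ≠ 1 → ∃ g, ¬ Commute x (g * y * g⁻¹))
    {n : ℕ} {Y Z : Set (Fin n → S)} (hY : IsAlgebraicSet Y) (hZ : IsAlgebraicSet Z) :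
    IsAlgebraicSet (Y ∪ Z) := by
  obtain ⟨E, rfl⟩ := hY
  obtain ⟨F, rfl⟩ := hZ
  refine ⟨{q | ∃ t ∈ E, ∃ t' ∈ F, ∃ (c d c' d' : S) (g : MaximalSubgroup he),
    q = CSTerm.commuteEquation g.1 (.quotient e c d t) (.quotient e c' d' t')}, ?_⟩
  ext p
  constructor
  · intro hp
    by_contra hne
    simp only [Set.mem_union, solutionSet, Set.mem_ofPred_eq, not_or, not_forall] at hne
    obtain ⟨⟨t, ht, htp⟩, t', ht', htp'⟩ := hne
    obtain ⟨c, d, hcd⟩ := hsep _ _ htp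
    obtain ⟨c', d', hcd'⟩ := hsep _ _ htp'
    obtain ⟨g, hg⟩ := hdom _ _ (mul_inv_eq_one.not.2 hcd) (mul_inv_eq_one.not.2 hcd')
    exact hg ((CSTerm.eval_commuteEquation (CSTerm.eval_quotient he c d t p)
      (CSTerm.eval_quotient he c' d' t' p) g).1 (hp _ ⟨t, ht, t', ht', c, d, c', d', g, rfl⟩))
  · rintro hp _ ⟨t, ht, t', ht', c, d, c', d', g, rfl⟩
    rw [CSTerm.eval_commuteEquation (CSTerm.eval_quotient he c d t p)
      (CSTerm.eval_quotient he c' d' t' p) g]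
    rcases hp with hp | hp
    · rw [hp t ht, mul_inv_cancel]
      exact Commute.one_left _
    · rw [hp t' ht', mul_inv_cancel, mul_one, mul_inv_cancel]
      exact Commute.one_right _

theorem isEquationalDomain_of_union
    (h : ∀ (n : ℕ) (Y Z : Set (Fin n → S)), IsAlgebraicSet Y → IsAlgebraicSet Z →
      IsAlgebraicSet (Y ∪ Z)) : IsEquationalDomain S := by
  intro n F hF
  induction F, hF using Set.Finite.induction_on with
  | empty => exact fun hne => absurd hne Set.not_nonempty_empty
  | @insert Y F _ _ ih =>
    intro _ hY
    rcases F.eq_empty_or_nonempty with rfl | hF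
    · simpa using hY Y (Set.mem_insert _ _)
    · rw [Set.sUnion_insert]
      exact h n _ _ (hY Y (Set.mem_insert _ _))
        (ih hF fun Z hZ => hY Z (Set.mem_insert_of_mem _ hZ))

end EquationalDomain

theorem mainTheorem3 {X : Type v} (n : ℕ) (hX : Nat.card X = n) (hn : 2 ≤ n)
    {S : Type u} [Semigroup S] [IsCompletelySimple S] (ι : X → S)
    (hfree : IsFreeCompletelySimple ι) :
    IsEquationalDomain S := by
  have : Finite X := Nat.finite_of_card_ne_zero (by omega)
  -- Freeness only tests targets in `Type u`, so the index set of the Rees matrix semigroup must lie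
  -- there too.
  let σ : ULift.{u} (Fin n) ≃ X := Equiv.ulift.trans (Finite.equivFinOfCardEq hX).symm
  have : Nontrivial (Fin n) := Fin.nontrivial_iff_two_le.2 hn
  obtain ⟨e, he, hsep, hdom⟩ := (hfree.comp_equiv σ).exists_idempotent
  exact isEquationalDomain_of_union fun n Y Z => isAlgebraicSet_union he hsep hdom
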